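/- Let $d\ge 1$ and $r>0$. Let $S^{d-1}$ be the unit sphere of $\mathbb{R}^d$ with the spherical Lebesgue measure $\mathrm{d}u$, and for $v_1,\dots,v_d\in\mathbb{R}^d$ let $\nabla_d(v_1,\dots,v_d)$ be the $d$-dimensional volume of the parallelotope spanned by $v_1,\dots,v_d$. Let $$T:\mathbb{R}^d\times(S^{d-1})^d\to(\mathbb{R}^d)^d,\qquad T(z,u_1,\dots,u_d)=(z+ru_1,\dots,z+ru_d).$$ Let $D\subset\mathbb{R}^d\times(S^{d-1})^d$ be a measurable set such that $T$ is injective on $D\setminus N$ for some set $N$ of measure zero; here measurability and measure zero refer to the (completed) product of the Lebesgue measure on $\mathbb{R}^d$ and the spherical Lebesgue measures. Then for every non-negative Lebesgue measurable function $f:(\mathbb{R}^d)^d\to\mathbb{R}$, $$\int_{T(D)} f(x_1,\dots,x_d)\,\mathrm{d}(x_1,\dots,x_d) =r^{d(d-1)}\int_{\mathbb{R}^d}\int_{S^{d-1}}\cdots\int_{S^{d-1}}\mathbf{1}\big((z,u_1,\dots,u_d)\in D\big)\,f(z+ru_1,\dots,z+ru_d)\,\nabla_d(u_1,\dots,u_d)\,\mathrm{d}u_1\cdots\mathrm{d}u_d\,\mathrm{d}z,$$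 as an identity in $[0,\infty]$, where the left-hand side is the integral over the set $T(D)\subset(\mathbb{R}^d)^d$ with respect to Lebesgue measure. -/

import Mathlib

open MeasureTheory
open scoped ENNReal

noncomputable section

/-- Euclidean space `ℝ^d` with its usual norm. -/
abbrev RSpace (d : ℕ) : Type := EuclideanSpace ℝ (Fin d)

/-- The unit sphere `S^{d-1}` of `ℝ^d`. -/
abbrev USphere (d : ℕ) : Type := Metric.sphere (0 : RSpace d) 1

/-- The spherical Lebesgue measure `σ_{d-1}` on `S^{d-1}`: the measure of `A` is `d` times the
Lebesgue measure of the cone `{t • u | 0 < t < 1, u ∈ A}`; the total mass is `d κ_d`. -/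
def sphereMeasure (d : ℕ) : Measure (USphere d) :=
  (volume : Measure (RSpace d)).toSphere

/-- The product measure `σ_{d-1} ⊗ ⋯ ⊗ σ_{d-1}` on `(S^{d-1})^d`. -/
def sphereProdMeasure (d : ℕ) : Measure (Fin d → USphere d) :=
  Measure.pi fun _ => sphereMeasure d

/-- `∇_d(v_1, …, v_d)`: the `d`-dimensional volume of the parallelotope
`{∑ i, t_i v_i | 0 ≤ t_i ≤ 1}` spanned by `v_1, …, v_d`. -/
def nablaVol (d : ℕ) (v : Fin d → RSpace d) : ℝ≥0∞ :=
  volume (parallelepiped v)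

/-- The map `T(z, u_1, …, u_d) = (z + r u_1, …, z + r u_d)`. -/
def sphereMap (d : ℕ) (r : ℝ) (p : RSpace d × (Fin d → USphere d)) : Fin d → RSpace d :=
  fun i => p.1 + r • (p.2 i : RSpace d)

end

/-!
Polar coordinates replace each sphere variable `u i` by a vector `x i = ρ i • u i` of `ℝ^d`. The
map `(z, x) ↦ ((‖x i‖ ^ d)_i, (z + r x i / ‖x i‖)_i)` acts between spaces of equal dimension and
takes `D × (0, 1)^d`, in these coordinates, onto `(0, 1)^d × T(D)`. Its derivative is a `2 × 2`
block matrix with a zero corner, whose determinant reduces to that of the matrix with rows `u i`.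
The Jacobian `d ^ d r ^ (d (d - 1)) ∇_d(u)` does not depend on the radii, so the ordinary change of
variables formula on `ℝ^d × (ℝ^d)^d` computes the integral over `T(D)`; the factor `d ^ d` cancels
the radial mass `d ^ (-d)` of `(0, 1)^d`.
-/

section LinearAlgebra

theorem det_fromBlocks_zero_one_sub_mul {R m n : Type*} [CommRing R] [Fintype m] [DecidableEq m]
    [Fintype n] [DecidableEq n] (B : Matrix m n R) (C S : Matrix n m R) :
    (Matrix.fromBlocks 0 B C (1 - S * B)).det = (-(B * C)).det := by
  have h : Matrix.fromBlocks 0 B C (1 - S * B) =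
      Matrix.fromBlocks 1 0 (-S) 1 * Matrix.fromBlocks 0 B C 1 := by
    simp [Matrix.fromBlocks_multiply, sub_eq_neg_add]
  rw [h, Matrix.det_mul, Matrix.det_fromBlocks_zero₁₂, Matrix.det_fromBlocks_one₂₂]
  simp

theorem det_prod_sub_comp {R M N : Type*} [CommRing R] [AddCommGroup M] [Module R M]
    [Module.Free R M] [Module.Finite R M] [AddCommGroup N] [Module R N] [Module.Free R N]
    [Module.Finite R N] (f : N →ₗ[R] M) (g s : M →ₗ[R] N) :
    LinearMap.det ((LinearMap.coprod 0 f).prod (g.coprod (LinearMap.id - s ∘ₗ f))) =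
      LinearMap.det (-(f ∘ₗ g)) := by
  classical
  let b := Module.Free.chooseBasis R M
  let c := Module.Free.chooseBasis R N
  have h : LinearMap.toMatrix (b.prod c) (b.prod c)
      ((LinearMap.coprod 0 f).prod (g.coprod (LinearMap.id - s ∘ₗ f))) =
      Matrix.fromBlocks 0 (LinearMap.toMatrix c b f) (LinearMap.toMatrix b c g)
        (1 - LinearMap.toMatrix b c s * LinearMap.toMatrix c b f) := by
    rw [← LinearMap.toMatrix_comp, ← LinearMap.toMatrix_id c, ← map_sub]
    ext (i | i) (j | j) <;>
      simp [LinearMap.toMatrix_apply, Matrix.one_apply, Finsupp.single_apply, eq_comm]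
  rw [← LinearMap.det_toMatrix (b.prod c), h, det_fromBlocks_zero_one_sub_mul,
    ← LinearMap.toMatrix_comp, ← map_neg, LinearMap.det_toMatrix]

theorem det_smul_id_add_smulRight {K V : Type*} [Field K] [AddCommGroup V] [Module K V]
    [FiniteDimensional K V] [Nontrivial V] (a : K) (f : Module.Dual K V) (v : V) :
    LinearMap.det (a • LinearMap.id + f.smulRight v) =
      a ^ (Module.finrank K V - 1) * (a + f v) := by
  let b := Module.finBasis K V
  have h : LinearMap.toMatrix b b (a • LinearMap.id + f.smulRight v) =
      Matrix.scalar _ a - Matrix.vecMulVec (-b.repr v) (f ∘ b) := by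
    ext i j
    simp [LinearMap.toMatrix_apply, Finsupp.single_apply, eq_comm, Matrix.vecMulVec_apply,
      mul_comm, Matrix.diagonal_apply]
  have hv : (⇑(b.repr v)) ⬝ᵥ (f ∘ b) = f v := by
    conv_rhs => rw [← b.sum_repr v, map_sum]
    simp only [dotProduct, Function.comp_apply, map_smul, smul_eq_mul]
  rw [← LinearMap.det_toMatrix b, h, ← Matrix.eval_charpoly, Matrix.charpoly_vecMulVec]
  simp only [Fintype.card_fin, Polynomial.eval_sub, Polynomial.eval_pow, Polynomial.eval_X,
    Polynomial.eval_smul, Finsupp.coe_neg, neg_dotProduct, hv, smul_eq_mul]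
  rw [← pow_sub_one_mul Module.finrank_pos.ne']
  ring

end LinearAlgebra

section Inner

variable {E : Type*} [NormedAddCommGroup E] [InnerProductSpace ℝ E]

theorem hasFDerivAt_norm {x : E} (hx : x ≠ 0) :
    HasFDerivAt (fun y : E => ‖y‖) (innerSL ℝ (NormedSpace.normalize x)) x := by
  have h := (hasStrictFDerivAt_norm_sq x).hasFDerivAt.sqrt (pow_ne_zero 2 (norm_ne_zero_iff.2 hx))
  simp only [Real.sqrt_sq (norm_nonneg _)] at h
  refine h.congr_fderiv ?_
  ext y
  simp only [NormedSpace.normalize, smul_apply, coe_innerSL_apply, map_smul, nsmul_eq_mul,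
    smul_eq_mul, Nat.cast_ofNat, one_div, mul_inv_rev]
  field_simp

theorem hasFDerivAt_normalize {x : E} (hx : x ≠ 0) :
    HasFDerivAt NormedSpace.normalize (‖x‖⁻¹ • (ContinuousLinearMap.id ℝ E -
      (innerSL ℝ (NormedSpace.normalize x)).smulRight (NormedSpace.normalize x))) x := by
  refine (((hasDerivAt_inv (norm_ne_zero_iff.2 hx)).comp_hasFDerivAt x
    (hasFDerivAt_norm hx)).smul (hasFDerivAt_id x)).congr_fderiv ?_
  ext y
  simp only [NormedSpace.normalize, Function.comp_apply, map_smul, smul_smul, neg_mul, neg_smul,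
    id_eq, add_apply, sub_apply, neg_apply, smul_apply, ContinuousLinearMap.id_apply,
    ContinuousLinearMap.smulRight_apply, coe_innerSL_apply, smul_eq_mul]
  field_simp
  module

/-- The linear map which, for a unit vector `u`, scales `u` by `c` and its orthogonal complement
by `a`. -/
noncomputable def radialScaling (a c : ℝ) (u : E) : E →ₗ[ℝ] E :=
  a • LinearMap.id + ((c - a) • innerₛₗ ℝ u).smulRight u

theorem det_radialScaling [FiniteDimensional ℝ E] (a c : ℝ) {u : E} (hu : ‖u‖ = 1) :
    LinearMap.det (radialScaling a c u) = a ^ (Module.finrank ℝ E - 1) * c := by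
  have : Nontrivial E := nontrivial_of_ne u 0 (norm_ne_zero_iff.1 (by simp [hu]))
  rw [radialScaling, det_smul_id_add_smulRight]
  simp [hu]

theorem inner_radialScaling (a c : ℝ) {u : E} (hu : ‖u‖ = 1) (y : E) :
    inner ℝ u (radialScaling a c u y) = c * inner ℝ u y := by
  simp only [radialScaling, LinearMap.add_apply, LinearMap.smul_apply, LinearMap.id_apply,
    LinearMap.smulRight_apply, innerₛₗ_apply_apply, smul_eq_mul, inner_add_right,
    inner_smul_right, real_inner_self_eq_norm_sq, hu]
  ring

end Inner

section Jacobian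

variable {d : ℕ}

/-- The linear map `w ↦ (⟪u i, w i⟫)_i`, taking the component of each `w i` along `u i`. -/
noncomputable def diagInner (u : Fin d → RSpace d) : (Fin d → RSpace d) →ₗ[ℝ] RSpace d :=
  (WithLp.linearEquiv 2 ℝ (Fin d → ℝ)).symm.toLinearMap ∘ₗ
    LinearMap.pi fun i => innerₛₗ ℝ (u i) ∘ₗ LinearMap.proj i

/-- The linear map `s ↦ (s i • u i)_i`, a right inverse of `diagInner u` for unit vectors `u i`. -/
noncomputable def diagSMul (u : Fin d → RSpace d) : RSpace d →ₗ[ℝ] (Fin d → RSpace d) :=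
  LinearMap.pi fun i => (EuclideanSpace.projₗ i).smulRight (u i)

theorem det_diagInner_comp_pi_id (u : Fin d → RSpace d) :
    LinearMap.det (diagInner u ∘ₗ LinearMap.pi fun _ => LinearMap.id) =
      Matrix.det fun i j => u i j := by
  rw [← LinearMap.det_toMatrix (EuclideanSpace.basisFun (Fin d) ℝ).toBasis]
  congr 1
  ext i j
  simp [LinearMap.toMatrix_apply, diagInner, EuclideanSpace.inner_single_right]

theorem nablaVol_eq_ofReal_abs_det (u : Fin d → RSpace d) :
    nablaVol d u = ENNReal.ofReal |Matrix.det fun i j => u i j| := by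
  rw [nablaVol, ← (EuclideanSpace.basisFun (Fin d) ℝ).addHaar_eq_volume,
    Measure.addHaar_parallelepiped, Module.Basis.det_apply, ← Matrix.det_transpose]
  rfl

theorem nablaVol_ne_top (u : Fin d → RSpace d) : nablaVol d u ≠ ∞ := by
  rw [nablaVol_eq_ofReal_abs_det]
  exact ENNReal.ofReal_ne_top

theorem measurable_nablaVol (d : ℕ) : Measurable (nablaVol d) := by
  have hdet : Continuous fun u : Fin d → RSpace d => Matrix.det fun i j => u i j :=
    Continuous.matrix_det (by fun_prop)
  rw [funext nablaVol_eq_ofReal_abs_det]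
  exact (ENNReal.continuous_ofReal.comp hdet.abs).measurable

/-- An extension of `sphereMap d r` to a map between spaces of equal dimension: `x i` enters the
second component only through its direction, and its norm is recorded in the first one. The
exponent `d` makes the Jacobian constant along radii. -/
noncomputable def radialMap (d : ℕ) (r : ℝ) (p : RSpace d × (Fin d → RSpace d)) :
    RSpace d × (Fin d → RSpace d) :=
  (WithLp.toLp 2 fun i => ‖p.2 i‖ ^ d, fun i => p.1 + r • NormedSpace.normalize (p.2 i))

/-- The derivative of `radialMap` at points whose `i`-th vector has direction `u i`, where `c i` is
the derivative of the radial function and `a i` that of the normalized direction. It is factored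
into a block map and a block diagonal map, so that its determinant can be read off; see
`radialMapDeriv_apply` for its values. -/
noncomputable def radialMapDeriv (u : Fin d → RSpace d) (a c : Fin d → ℝ) :
    (RSpace d × (Fin d → RSpace d)) →ₗ[ℝ] RSpace d × (Fin d → RSpace d) :=
  (LinearMap.coprod 0 (diagInner u)).prod
      ((LinearMap.pi fun _ => LinearMap.id).coprod
        (LinearMap.id - diagSMul u ∘ₗ diagInner u)) ∘ₗ
    LinearMap.id.prodMap
      (LinearMap.pi fun i => radialScaling (a i) (c i) (u i) ∘ₗ LinearMap.proj i)

theorem radialMapDeriv_apply {u : Fin d → RSpace d} (hu : ∀ i, ‖u i‖ = 1) (a c : Fin d → ℝ)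
    (z : RSpace d) (y : Fin d → RSpace d) :
    radialMapDeriv u a c (z, y) = (WithLp.toLp 2 fun i => c i * inner ℝ (u i) (y i),
      fun i => z + a i • (y i - (inner ℝ (u i) (y i) : ℝ) • u i)) := by
  refine Prod.ext ?_ (funext fun i => ?_)
  · ext i
    exact (zero_add _).trans (inner_radialScaling (a i) (c i) (hu i) (y i))
  · change z + (radialScaling (a i) (c i) (u i) (y i) -
      inner ℝ (u i) (radialScaling (a i) (c i) (u i) (y i)) • u i) = _
    rw [inner_radialScaling _ _ (hu i)]
    simp only [radialScaling, LinearMap.add_apply, LinearMap.smul_apply, LinearMap.id_apply,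
      LinearMap.smulRight_apply, innerₛₗ_apply_apply, smul_eq_mul]
    module

theorem abs_det_radialMapDeriv {u : Fin d → RSpace d} (hu : ∀ i, ‖u i‖ = 1) (a c : Fin d → ℝ) :
    |LinearMap.det (radialMapDeriv u a c)| =
      |∏ i, a i ^ (d - 1) * c i| * |Matrix.det fun i j => u i j| := by
  rw [radialMapDeriv, LinearMap.det_comp, det_prod_sub_comp, LinearMap.det_prodMap,
    LinearMap.det_id, one_mul, LinearMap.det_pi, abs_mul, mul_comm,
    ← neg_one_smul ℝ (diagInner u ∘ₗ _), LinearMap.det_smul, abs_mul, abs_pow, abs_neg, abs_one,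
    one_pow, one_mul, det_diagInner_comp_pi_id]
  simp only [det_radialScaling _ _ (hu _), finrank_euclideanSpace_fin]

theorem hasFDerivAt_radialMap (r : ℝ) {p : RSpace d × (Fin d → RSpace d)}
    (hp : ∀ i, p.2 i ≠ 0) :
    HasFDerivAt (radialMap d r)
      (radialMapDeriv (fun i => NormedSpace.normalize (p.2 i)) (fun i => r * ‖p.2 i‖⁻¹)
        fun i => d * ‖p.2 i‖ ^ (d - 1)).toContinuousLinearMap p := by
  have hproj : ∀ i, HasFDerivAt (fun q : RSpace d × (Fin d → RSpace d) => q.2 i)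
      (.comp (.proj i) (.snd ℝ (RSpace d) (Fin d → RSpace d))) p := fun i =>
    ((ContinuousLinearMap.proj i).comp
      (ContinuousLinearMap.snd ℝ (RSpace d) (Fin d → RSpace d))).hasFDerivAt
  have hnorm : ∀ i, HasFDerivAt
      (fun q : RSpace d × (Fin d → RSpace d) => ‖q.2 i‖ ^ d) _ p := fun i =>
    ((hasFDerivAt_norm (hp i)).comp p (hproj i)).pow d
  have hpoint : ∀ i, HasFDerivAt
      (fun q : RSpace d × (Fin d → RSpace d) => q.1 + r • NormedSpace.normalize (q.2 i)) _ p :=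
    fun i => hasFDerivAt_fst.add (((hasFDerivAt_normalize (hp i)).comp p (hproj i)).const_smul r)
  refine ((((PiLp.continuousLinearEquiv 2 ℝ fun _ : Fin d => ℝ).symm.hasFDerivAt).comp p
    (hasFDerivAt_pi.2 hnorm)).prodMk (hasFDerivAt_pi.2 hpoint)).congr_fderiv ?_
  refine ContinuousLinearMap.ext fun ⟨z, y⟩ => ?_
  rw [LinearMap.coe_toContinuousLinearMap',
    radialMapDeriv_apply fun i => NormedSpace.norm_normalize_eq_one_iff.2 (hp i)]
  refine Prod.ext ?_ (funext fun i => ?_)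
  · ext i
    simp
  · simp [smul_smul]

theorem ofReal_abs_det_radialMapDeriv (r : ℝ) {x : Fin d → RSpace d} (hx : ∀ i, x i ≠ 0) :
    ENNReal.ofReal |LinearMap.det
      (radialMapDeriv (fun i => NormedSpace.normalize (x i)) (fun i => r * ‖x i‖⁻¹)
        fun i => d * ‖x i‖ ^ (d - 1))| =
      d ^ d * (ENNReal.ofReal (r ^ (d * (d - 1))) *
        nablaVol d fun i => NormedSpace.normalize (x i)) := by
  have hfactor : ∀ i, (r * ‖x i‖⁻¹) ^ (d - 1) * (d * ‖x i‖ ^ (d - 1)) = r ^ (d - 1) * d := by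
    intro i
    rw [mul_left_comm, ← mul_pow, inv_mul_cancel_right₀ (norm_ne_zero_iff.2 (hx i)), mul_comm]
  have hprod : |∏ i, (r * ‖x i‖⁻¹) ^ (d - 1) * (d * ‖x i‖ ^ (d - 1))| =
      d ^ d * r ^ (d * (d - 1)) := by
    have hnonneg : 0 ≤ r ^ (d * (d - 1)) := (Nat.even_mul_pred_self d).pow_nonneg r
    rw [Finset.prod_congr rfl fun i _ => hfactor i, Finset.prod_const, Finset.card_univ,
      Fintype.card_fin, mul_pow, ← pow_mul, mul_comm (d - 1), mul_comm,
      abs_of_nonneg (by positivity)]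
  rw [abs_det_radialMapDeriv fun i => NormedSpace.norm_normalize_eq_one_iff.2 (hx i), hprod,
    ENNReal.ofReal_mul' (abs_nonneg _), ENNReal.ofReal_mul (by positivity),
    ENNReal.ofReal_pow (by positivity), ENNReal.ofReal_natCast, ← nablaVol_eq_ofReal_abs_det,
    mul_assoc]

end Jacobian

section PolarCoordinates

theorem measurePreserving_smul_sphere {E : Type*} [NormedAddCommGroup E] [NormedSpace ℝ E]
    [FiniteDimensional ℝ E] [Nontrivial E] [MeasurableSpace E] [BorelSpace E] (μ : Measure E)
    [μ.IsAddHaarMeasure] :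
    MeasurePreserving (fun q : Metric.sphere (0 : E) 1 × Set.Ioi (0 : ℝ) => (q.2 : ℝ) • (q.1 : E))
      (μ.toSphere.prod (Measure.volumeIoiPow (Module.finrank ℝ E - 1))) μ := by
  have hcompl : MeasurePreserving (Subtype.val : ({0}ᶜ : Set E) → E) (μ.comap Subtype.val) μ := by
    refine ⟨measurable_subtype_coe, ?_⟩
    rw [map_comap_subtype_coe (measurableSet_singleton _).compl, restrict_compl_singleton]
  exact hcompl.comp (MeasurePreserving.symm (homeomorphUnitSphereProd E).toMeasurableEquiv
    μ.measurePreserving_homeomorphUnitSphereProd)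

instance (d : ℕ) : IsFiniteMeasure (sphereMeasure d) :=
  inferInstanceAs (IsFiniteMeasure (Measure.toSphere _))

instance (d : ℕ) : IsFiniteMeasure (sphereProdMeasure d) :=
  inferInstanceAs (IsFiniteMeasure (Measure.pi _))

/-- The product over `d` components of the radial measures `ρ ^ (d - 1) dρ` on `(0, ∞)`. -/
noncomputable def radialMeasure (d : ℕ) : Measure (Fin d → Set.Ioi (0 : ℝ)) :=
  Measure.pi fun _ => Measure.volumeIoiPow (d - 1)

instance (d : ℕ) : SigmaFinite (radialMeasure d) :=
  inferInstanceAs (SigmaFinite (Measure.pi _))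

/-- Polar coordinates in the `d` vector components: `((z, u), ρ) ↦ (z, (ρ i • u i)_i)`. -/
def polarMap (d : ℕ) (q : (RSpace d × (Fin d → USphere d)) × (Fin d → Set.Ioi (0 : ℝ))) :
    RSpace d × (Fin d → RSpace d) :=
  (q.1.1, fun i => (q.2 i : ℝ) • (q.1.2 i : RSpace d))

theorem measurePreserving_polarMap (d : ℕ) :
    MeasurePreserving (polarMap d)
      ((volume.prod (sphereProdMeasure d)).prod (radialMeasure d)) (volume.prod volume) := by
  have hpolar (i : Fin d) : MeasurePreserving
      (fun q : USphere d × Set.Ioi (0 : ℝ) => (q.2 : ℝ) • (q.1 : RSpace d))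
      ((sphereMeasure d).prod (Measure.volumeIoiPow (d - 1))) volume := by
    have : Nonempty (Fin d) := ⟨i⟩
    simpa only [finrank_euclideanSpace_fin, sphereMeasure] using
      measurePreserving_smul_sphere (volume : Measure (RSpace d))
  have hpi := (measurePreserving_pi _ _ hpolar).comp
    (measurePreserving_arrowProdEquivProdArrow _ _ _ _ _).symm
  exact ((MeasurePreserving.id volume).prod hpi).comp (measurePreserving_prodAssoc _ _ _)

section

variable {d : ℕ} (q : (RSpace d × (Fin d → USphere d)) × (Fin d → Set.Ioi (0 : ℝ)))

theorem polarMap_snd_ne_zero (i : Fin d) : (polarMap d q).2 i ≠ 0 :=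
  smul_ne_zero (ne_of_gt (q.2 i).2) (ne_zero_of_mem_unit_sphere _)

theorem norm_polarMap_snd (i : Fin d) : ‖(polarMap d q).2 i‖ = q.2 i := by
  rw [polarMap, norm_smul, norm_eq_of_mem_sphere, mul_one, Real.norm_of_nonneg (q.2 i).2.le]

theorem normalize_polarMap_snd (i : Fin d) :
    NormedSpace.normalize ((polarMap d q).2 i) = q.1.2 i := by
  rw [polarMap, NormedSpace.normalize_smul_of_pos (q.2 i).2,
    NormedSpace.normalize_eq_self_of_norm_eq_one (norm_eq_of_mem_sphere _)]

theorem radialMap_polarMap (r : ℝ) :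
    radialMap d r (polarMap d q) =
      (WithLp.toLp 2 fun i => (q.2 i : ℝ) ^ d, sphereMap d r q.1) := by
  simp only [radialMap, norm_polarMap_snd, normalize_polarMap_snd]
  rfl

end

theorem polarMap_injective (d : ℕ) : Function.Injective (polarMap d) := by
  intro q q' h
  refine Prod.ext (Prod.ext (congrArg (fun p => p.1) h) (funext fun i => Subtype.ext ?_))
    (funext fun i => Subtype.ext ?_)
  · rw [← normalize_polarMap_snd, h, normalize_polarMap_snd]
  · rw [← norm_polarMap_snd, h, norm_polarMap_snd]

theorem measurableEmbedding_polarMap (d : ℕ) : MeasurableEmbedding (polarMap d) := by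
  have : StandardBorelSpace (Set.Ioi (0 : ℝ)) := measurableSet_Ioi.standardBorel
  have : StandardBorelSpace (USphere d) := Metric.isClosed_sphere.measurableSet.standardBorel
  exact (measurePreserving_polarMap d).measurable.measurableEmbedding (polarMap_injective d)

/-- The open unit cube `(0, 1)^d` in `ℝ^d`. -/
def openUnitCube (d : ℕ) : Set (RSpace d) := WithLp.ofLp ⁻¹' Set.univ.pi fun _ => Set.Ioo 0 1

theorem volume_openUnitCube (d : ℕ) : volume (openUnitCube d) = 1 := by
  rw [openUnitCube, (PiLp.volume_preserving_ofLp (Fin d)).measure_preimage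
    (MeasurableSet.univ_pi fun _ => measurableSet_Ioo).nullMeasurableSet, volume_pi_pi]
  simp

/-- The radii `ρ` with all components in `(0, 1)`. -/
def unitRadii (d : ℕ) : Set (Fin d → Set.Ioi (0 : ℝ)) :=
  Set.univ.pi fun _ => Set.Iio ⟨1, Set.mem_Ioi.2 one_pos⟩

theorem measurableSet_unitRadii (d : ℕ) : MeasurableSet (unitRadii d) :=
  MeasurableSet.univ_pi fun _ => measurableSet_Iio

theorem radialMeasure_unitRadii (d : ℕ) : radialMeasure d (unitRadii d) = ((d : ℝ≥0∞) ^ d)⁻¹ := by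
  have hradius (i : Fin d) : Measure.volumeIoiPow (d - 1) (Set.Iio ⟨1, Set.mem_Ioi.2 one_pos⟩) =
      (d : ℝ≥0∞)⁻¹ := by
    rw [Measure.volumeIoiPow_apply_Iio, one_pow, Nat.cast_pred i.pos, sub_add_cancel, one_div,
      ENNReal.ofReal_inv_of_pos (by exact_mod_cast i.pos), ENNReal.ofReal_natCast]
  rw [radialMeasure, unitRadii, Measure.pi_pi, Finset.prod_congr rfl fun i _ => hradius i,
    Finset.prod_const, Finset.card_univ, Fintype.card_fin, ENNReal.inv_pow]

theorem image_radialMap_polarMap (d : ℕ) (r : ℝ) (D : Set (RSpace d × (Fin d → USphere d))) :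
    radialMap d r '' (polarMap d '' (D ×ˢ unitRadii d)) =
      openUnitCube d ×ˢ (sphereMap d r '' D) := by
  rw [Set.image_image]
  simp only [radialMap_polarMap]
  ext ⟨s, y⟩
  constructor
  · rintro ⟨⟨p, ρ⟩, ⟨hp, hρ⟩, h⟩
    obtain ⟨rfl, rfl⟩ := Prod.ext_iff.1 h
    exact ⟨fun i _ => ⟨pow_pos (ρ i).2 _,
      pow_lt_one₀ (ρ i).2.le (hρ i (Set.mem_univ i)) i.pos.ne'⟩, p, hp, rfl⟩
  · rintro ⟨hs, p, hp, rfl⟩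
    refine ⟨(p, fun i => ⟨s i ^ (d : ℝ)⁻¹, Real.rpow_pos_of_pos (hs i trivial).1 _⟩),
      ⟨hp, fun i _ => ?_⟩, Prod.ext ?_ rfl⟩
    · have hd : (0 : ℝ) < d := by exact_mod_cast i.pos
      exact Real.rpow_lt_one (hs i trivial).1.le (hs i trivial).2 (inv_pos.2 hd)
    · ext i
      exact Real.rpow_inv_natCast_pow (hs i trivial).1.le i.pos.ne'

theorem injOn_radialMap {d : ℕ} {r : ℝ} {D : Set (RSpace d × (Fin d → USphere d))}
    (hD : Set.InjOn (sphereMap d r) D) (R : Set (Fin d → Set.Ioi (0 : ℝ))) :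
    Set.InjOn (radialMap d r) (polarMap d '' (D ×ˢ R)) := by
  rintro _ ⟨q, ⟨hq, -⟩, rfl⟩ _ ⟨q', ⟨hq', -⟩, rfl⟩ h
  rw [radialMap_polarMap, radialMap_polarMap, Prod.mk.injEq] at h
  refine congrArg _ (Prod.ext (hD hq hq' h.2) (funext fun i => Subtype.ext ?_))
  exact (pow_left_inj₀ (q.2 i).2.le (q'.2 i).2.le i.pos.ne').1
    (congrArg (fun s : RSpace d => s i) h.1)

end PolarCoordinates

section ChangeOfVariables

theorem aemeasurable_mul_of_withDensity {α : Type*} [MeasurableSpace α] {μ : Measure α}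
    {J g : α → ℝ≥0∞} (hJ : Measurable J) (hJ_top : ∀ x, J x ≠ ∞)
    (hg : AEMeasurable g (μ.withDensity J)) : AEMeasurable (J * g) μ := by
  have hcoe : (fun x => ((J x).toNNReal : ℝ≥0∞)) = J :=
    funext fun x => ENNReal.coe_toNNReal (hJ_top x)
  rw [← hcoe, aemeasurable_withDensity_ennreal_iff hJ.ennreal_toNNReal] at hg
  simpa only [ENNReal.coe_toNNReal (hJ_top _)] using! hg

variable {d : ℕ} {r : ℝ}

/-- The Jacobian `r ^ (d (d - 1)) ∇_d(u)` of `sphereMap d r` at `(z, u)`. -/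
noncomputable def sphereJacobian (d : ℕ) (r : ℝ) (p : RSpace d × (Fin d → USphere d)) : ℝ≥0∞ :=
  ENNReal.ofReal (r ^ (d * (d - 1))) * nablaVol d fun i => (p.2 i : RSpace d)

theorem measurable_sphereJacobian (d : ℕ) (r : ℝ) : Measurable (sphereJacobian d r) :=
  ((measurable_nablaVol d).comp (by fun_prop)).const_mul _

theorem sphereJacobian_ne_top (p : RSpace d × (Fin d → USphere d)) : sphereJacobian d r p ≠ ∞ :=
  ENNReal.mul_ne_top ENNReal.ofReal_ne_top (nablaVol_ne_top _)

theorem measurable_sphereMap (d : ℕ) (r : ℝ) : Measurable (sphereMap d r) := by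
  unfold sphereMap
  fun_prop

theorem differentiableAt_radialMap_polarMap
    (q : (RSpace d × (Fin d → USphere d)) × (Fin d → Set.Ioi (0 : ℝ))) :
    DifferentiableAt ℝ (radialMap d r) (polarMap d q) :=
  (hasFDerivAt_radialMap r (polarMap_snd_ne_zero q)).differentiableAt

theorem abs_det_fderiv_radialMap_polarMap
    (q : (RSpace d × (Fin d → USphere d)) × (Fin d → Set.Ioi (0 : ℝ))) :
    ENNReal.ofReal |(fderiv ℝ (radialMap d r) (polarMap d q)).det| =
      d ^ d * sphereJacobian d r q.1 := by
  rw [(hasFDerivAt_radialMap r (polarMap_snd_ne_zero q)).fderiv,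
    LinearMap.det_toContinuousLinearMap, ofReal_abs_det_radialMapDeriv r (polarMap_snd_ne_zero q)]
  simp only [normalize_polarMap_snd, sphereJacobian]

instance (d : ℕ) :
    ((volume : Measure (RSpace d)).prod (volume : Measure (Fin d → RSpace d))).IsAddHaarMeasure :=
  Measure.prod.instIsAddHaarMeasure _ _

theorem lintegral_openUnitCube_prod_snd {g : (Fin d → RSpace d) → ℝ≥0∞} (hg : Measurable g)
    (A : Set (Fin d → RSpace d)) :
    ∫⁻ y in openUnitCube d ×ˢ A, g y.2 ∂(volume.prod volume) = ∫⁻ x in A, g x := by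
  rw [← Measure.prod_restrict,
    lintegral_prod (fun y => g y.2) (hg.comp measurable_snd).aemeasurable]
  simp [volume_openUnitCube]

theorem lintegral_image_polarMap_unitRadii {h : RSpace d × (Fin d → USphere d) → ℝ≥0∞}
    (hh : Measurable h) {H : RSpace d × (Fin d → RSpace d) → ℝ≥0∞}
    (hH : ∀ q, H (polarMap d q) = d ^ d * h q.1) (D : Set (RSpace d × (Fin d → USphere d))) :
    ∫⁻ x in polarMap d '' (D ×ˢ unitRadii d), H x ∂(volume.prod volume) =
      ∫⁻ p in D, h p ∂(volume.prod (sphereProdMeasure d)) := by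
  have hcancel : (d : ℝ≥0∞) ^ d * ((d : ℝ≥0∞) ^ d)⁻¹ = 1 :=
    ENNReal.mul_inv_cancel (by exact_mod_cast Nat.pow_self_pos.ne')
      (ENNReal.pow_ne_top (ENNReal.natCast_ne_top d))
  rw [← (measurePreserving_polarMap d).setLIntegral_comp_emb (measurableEmbedding_polarMap d),
    ← Measure.prod_restrict]
  simp only [hH]
  rw [lintegral_prod (fun q => d ^ d * h q.1) ((hh.comp measurable_fst).const_mul _).aemeasurable]
  simp only [lintegral_const, Measure.restrict_apply_univ, radialMeasure_unitRadii,
    mul_right_comm _ (h _), hcancel, one_mul]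

theorem map_sphereMap_withDensity_of_measurableSet {D : Set (RSpace d × (Fin d → USphere d))}
    (hD : MeasurableSet D) (hinj : Set.InjOn (sphereMap d r) D) :
    (((volume.prod (sphereProdMeasure d)).restrict D).withDensity (sphereJacobian d r)).map
      (sphereMap d r) = volume.restrict (sphereMap d r '' D) := by
  have hS : MeasurableSet (polarMap d '' (D ×ˢ unitRadii d)) :=
    (measurableEmbedding_polarMap d).measurableSet_image.2 (hD.prod (measurableSet_unitRadii d))
  refine Measure.ext_of_lintegral _ fun g hg => ?_
  have hgT : Measurable fun p => g (sphereMap d r p) := hg.comp (measurable_sphereMap d r)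
  calc ∫⁻ x, g x ∂(Measure.map (sphereMap d r) _)
    _ = ∫⁻ p in D, sphereJacobian d r p * g (sphereMap d r p)
          ∂(volume.prod (sphereProdMeasure d)) := by
      rw [lintegral_map hg (measurable_sphereMap d r),
        lintegral_withDensity_eq_lintegral_mul _ (measurable_sphereJacobian d r) hgT]
      rfl
    _ = ∫⁻ x in polarMap d '' (D ×ˢ unitRadii d),
          ENNReal.ofReal |(fderiv ℝ (radialMap d r) x).det| * g (radialMap d r x).2
          ∂(volume.prod volume) := by
      refine (lintegral_image_polarMap_unitRadii ((measurable_sphereJacobian d r).mul hgT)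
        (fun q => ?_) D).symm
      rw [abs_det_fderiv_radialMap_polarMap, radialMap_polarMap, mul_assoc]
      rfl
    _ = ∫⁻ y in radialMap d r '' (polarMap d '' (D ×ˢ unitRadii d)), g y.2
          ∂(volume.prod volume) := by
      refine (lintegral_image_eq_lintegral_abs_det_fderiv_mul _ hS ?_
        (injOn_radialMap hinj _) fun y => g y.2).symm
      rintro _ ⟨q, -, rfl⟩
      exact (differentiableAt_radialMap_polarMap q).hasFDerivAt.hasFDerivWithinAt
    _ = ∫⁻ x in sphereMap d r '' D, g x := by
      rw [image_radialMap_polarMap, lintegral_openUnitCube_prod_snd hg]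

theorem volume_image_sphereMap_eq_zero (r : ℝ) {N : Set (RSpace d × (Fin d → USphere d))}
    (hN : ((volume : Measure (RSpace d)).prod (sphereProdMeasure d)) N = 0) :
    volume (sphereMap d r '' N) = 0 := by
  have hpolar : (volume.prod volume) (polarMap d '' (N ×ˢ unitRadii d)) = 0 := by
    rw [← (measurePreserving_polarMap d).measure_preimage_emb (measurableEmbedding_polarMap d),
      Set.preimage_image_eq _ (polarMap_injective d), Measure.prod_prod, hN, zero_mul]
  have himage : (volume.prod volume) (openUnitCube d ×ˢ (sphereMap d r '' N)) = 0 := by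
    rw [← image_radialMap_polarMap]
    refine addHaar_image_eq_zero_of_differentiableOn_of_addHaar_eq_zero _ ?_ hpolar
    rintro _ ⟨q, -, rfl⟩
    exact (differentiableAt_radialMap_polarMap q).differentiableWithinAt
  rwa [Measure.prod_prod, volume_openUnitCube, one_mul] at himage

theorem image_sphereMap_ae_eq {D D' : Set (RSpace d × (Fin d → USphere d))}
    (h : D =ᵐ[(volume : Measure (RSpace d)).prod (sphereProdMeasure d)] D') :
    (sphereMap d r '' D : Set (Fin d → RSpace d)) =ᵐ[volume] sphereMap d r '' D' := by
  have hle {A B : Set (RSpace d × (Fin d → USphere d))}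
      (hAB : A ≤ᵐ[(volume : Measure (RSpace d)).prod (sphereProdMeasure d)] B) :
      (sphereMap d r '' A : Set (Fin d → RSpace d)) ≤ᵐ[volume] sphereMap d r '' B := by
    refine ae_le_set.2 (measure_mono_null ?_ (volume_image_sphereMap_eq_zero r (ae_le_set.1 hAB)))
    rintro _ ⟨⟨p, hpA, rfl⟩, hpB⟩
    exact ⟨p, ⟨hpA, fun hp => hpB ⟨p, hp, rfl⟩⟩, rfl⟩
  exact (hle h.le).antisymm (hle h.symm.le)

theorem map_sphereMap_withDensity {D N : Set (RSpace d × (Fin d → USphere d))}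
    (hD : NullMeasurableSet D ((volume : Measure (RSpace d)).prod (sphereProdMeasure d)))
    (hN : ((volume : Measure (RSpace d)).prod (sphereProdMeasure d)) N = 0)
    (hinj : Set.InjOn (sphereMap d r) (D \ N)) :
    (((volume.prod (sphereProdMeasure d)).restrict D).withDensity (sphereJacobian d r)).map
      (sphereMap d r) = volume.restrict (sphereMap d r '' D) := by
  obtain ⟨D', hsub, hmeas, hae⟩ :=
    (hD.diff (NullMeasurableSet.of_null hN)).exists_measurable_subset_ae_eq
  have hD' : D' =ᵐ[(volume : Measure (RSpace d)).prod (sphereProdMeasure d)] D :=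
    hae.trans (sdiff_null_ae_eq_self hN)
  rw [← Measure.restrict_congr_set hD', ← Measure.restrict_congr_set (image_sphereMap_ae_eq hD')]
  exact map_sphereMap_withDensity_of_measurableSet hmeas (hinj.mono hsub)

theorem lemma2p1_general (d : ℕ) (r : ℝ) (D : Set (RSpace d × (Fin d → USphere d)))
    (hD : NullMeasurableSet D ((volume : Measure (RSpace d)).prod (sphereProdMeasure d)))
    (hT : ∃ N : Set (RSpace d × (Fin d → USphere d)),
      ((volume : Measure (RSpace d)).prod (sphereProdMeasure d)) N = 0 ∧
        Set.InjOn (sphereMap d r) (D \ N))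
    (f : (Fin d → RSpace d) → ℝ≥0∞) (hf : AEMeasurable f volume) :
    ∫⁻ x in sphereMap d r '' D, f x =
      ENNReal.ofReal (r ^ (d * (d - 1))) *
        ∫⁻ z : RSpace d, ∫⁻ u : Fin d → USphere d,
          D.indicator 1 (z, u) * f (fun i => z + r • (u i : RSpace d)) *
            nablaVol d (fun i => (u i : RSpace d)) ∂(sphereProdMeasure d) := by
  obtain ⟨N, hN, hinj⟩ := hT
  have hmap := map_sphereMap_withDensity hD hN hinj
  have hfmap : AEMeasurable f (Measure.map (sphereMap d r) _) := hmap.symm ▸ hf.restrict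
  have hfT : AEMeasurable (fun p => f (sphereMap d r p)) _ :=
    hfmap.comp_measurable (measurable_sphereMap d r)
  have hint := aemeasurable_mul_of_withDensity (measurable_sphereJacobian d r)
    sphereJacobian_ne_top hfT
  rw [← hmap, lintegral_map' hfmap (measurable_sphereMap d r).aemeasurable,
    lintegral_withDensity_eq_lintegral_mul₀' (measurable_sphereJacobian d r).aemeasurable hfT,
    ← lintegral_indicator₀ hD, lintegral_prod _ ((aemeasurable_indicator_iff₀ hD).2 hint)]
  simp only [← lintegral_const_mul' _ _ ENNReal.ofReal_ne_top]
  refine lintegral_congr fun z => lintegral_congr fun u => ?_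
  by_cases hp : (z, u) ∈ D
  · rw [Set.indicator_of_mem hp, Set.indicator_of_mem hp, Pi.mul_apply, Pi.one_apply, one_mul,
      sphereJacobian, mul_assoc, mul_comm (nablaVol d _)]
    rfl
  · simp only [Set.indicator_of_notMem hp, zero_mul, mul_zero]

end ChangeOfVariables

theorem lemma2p1 (d : ℕ) (hd : 1 ≤ d) (r : ℝ) (hr : 0 < r)
    (D : Set (RSpace d × (Fin d → USphere d)))
    (hD : NullMeasurableSet D ((volume : Measure (RSpace d)).prod (sphereProdMeasure d)))
    (hT : ∃ N : Set (RSpace d × (Fin d → USphere d)),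
      ((volume : Measure (RSpace d)).prod (sphereProdMeasure d)) N = 0 ∧
        Set.InjOn (sphereMap d r) (D \ N))
    (f : (Fin d → RSpace d) → ℝ) (hf : AEMeasurable f volume) (hf0 : ∀ x, 0 ≤ f x) :
    ∫⁻ x in sphereMap d r '' D, ENNReal.ofReal (f x) =
      ENNReal.ofReal (r ^ (d * (d - 1))) *
        ∫⁻ z : RSpace d, ∫⁻ u : Fin d → USphere d,
          D.indicator 1 (z, u) * ENNReal.ofReal (f fun i => z + r • (u i : RSpace d)) *
            nablaVol d (fun i => (u i : RSpace d)) ∂(sphereProdMeasure d) :=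
  lemma2p1_general d r D hD hT _ hf.ennreal_ofReal
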